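/- Let $\Delta$ be a finite (reduced, crystallographic) root system with Weyl group $W$, let $\pi$ be a base of $\Delta$, and let $S\subset W$ be the corresponding set of simple reflections. Fix a real number $q>1$ and let $\mathbb{H}_q$ be the Hecke algebra of $(W,S)$: the unital associative $\mathbb{R}$-algebra with generators $H_s$, $s\in S$, subject to the braid relations $\cdots H_sH_t=\cdots H_tH_s$ (both sides alternating products with $m(s,t)$ factors, where $m(s,t)$ is the order of $st$) and to $H_s^2=(q-1)H_s+q$ for $s\in S$. Then the following hold. 1. For $w\in W$ with reduced expression $w=s_1s_2\cdots s_k$ (such an expression exists), the element $H_w:=H_{s_1}H_{s_2}\cdots H_{s_k}$ does not depend on the choice of the reduced expression, and $\{H_w\mid w\in W\}$ is a basis of $\mathbb{H}_q$ (the standard basis). 2. The structure constants of this basis, defined by $H_xH_y=\sum_{z\in W}c_{x,y}^zH_z$, satisfy $c_{x,y}^z\ge 0$ for all $x,y,z\in W$. 3. Set $x*y:=\{z\in W\mid c_{x,y}^z>0\}$ for $x,y\in W$. Then $(W,*)$ is a multigroup with identity $e$ (the identity element of $W$) and inverse $w\mapsto w^{-1}$. That is, for all $a,b,c\in W$: -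 $\bigcup_{t\in b*c}a*t=\bigcup_{s\in a*b}s*c$ (so that $(W,*)$ is a multisemigroup); - $e*a=a*e=\{a\}$; - $e\in a*b$ if and only if $b=a^{-1}$, and $e\in c*a$ if and only if $c=a^{-1}$; - $c\in a*b$ if and only if $c^{-1}\in b^{-1}*a^{-1}$. -/

import Mathlib

noncomputable section

/-! ### Multisemigroups and multigroups -/

/-- `op : S → S → Set S` makes the non-empty set `S` into a multisemigroup:
`⋃_{t ∈ b * c} a * t = ⋃_{s ∈ a * b} s * c` for all `a b c`. -/
structure IsMultisemigroup {S : Type*} (op : S → S → Set S) : Prop where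
  nonempty : Nonempty S
  assoc : ∀ a b c : S, (⋃ t ∈ op b c, op a t) = ⋃ s ∈ op a b, op s c

/-- `(S, op)` is a multigroup with identity element `e` and inverse map `inv`. -/
structure IsMultigroup {S : Type*} (op : S → S → Set S) (e : S) (inv : S → S) : Prop
    extends IsMultisemigroup op where
  one_op : ∀ a : S, op e a = {a}
  op_one : ∀ a : S, op a e = {a}
  /-- The element `inv a` is the unique `b` with `e ∈ a * b`. -/
  mem_op_right_iff : ∀ a b : S, e ∈ op a b ↔ b = inv a
  /-- The element `inv a` is the unique `c` with `e ∈ c * a`. -/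
  mem_op_left_iff : ∀ a c : S, e ∈ op c a ↔ c = inv a
  mem_op_iff : ∀ a b c : S, c ∈ op a b ↔ inv c ∈ op (inv b) (inv a)

/-- The structure constant `c_{x,y}^z` of a basis `H` of a real algebra: the coefficient of `H z`
in `H x * H y`. -/
def structureConstant {S A : Type*} [Ring A] [Algebra ℝ A] (H : Module.Basis S ℝ A)
    (x y z : S) : ℝ :=
  H.repr (H x * H y) z

/-- The multioperation on the index set of a basis: `x * y = {z | c_{x,y}^z > 0}`. -/
def basisOp {S A : Type*} [Ring A] [Algebra ℝ A] (H : Module.Basis S ℝ A)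
    (x y : S) : Set S :=
  {z | 0 < structureConstant H x y z}

/-! ### Hecke algebras -/

/-- The word `ω` in the letters `B` is a reduced expression of `w` with respect to the family
`s : B → W`: its product is `w`, and no shorter word has product `w`. -/
def IsReducedExpression {B W : Type*} [Group W] (s : B → W) (ω : List B) (w : W) : Prop :=
  (ω.map s).prod = w ∧ ∀ ω' : List B, (ω'.map s).prod = w → ω.length ≤ ω'.length

/-- The defining relations of the Hecke algebra: the braid relations
`⋯ H_i H_j = ⋯ H_j H_i` with `m(i,j)` factors on both sides, where `m(i,j)` is the order
of `s i * s j`, and the quadratic relations `H_i ^ 2 = (q - 1) H_i + q`. -/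
inductive HeckeRel {B W : Type*} [Group W] (s : B → W) (q : ℝ) :
    FreeAlgebra ℝ B → FreeAlgebra ℝ B → Prop
  | braid (i j : B) : HeckeRel s q
      (((CoxeterSystem.alternatingWord i j (orderOf (s i * s j))).map (FreeAlgebra.ι ℝ)).prod)
      (((CoxeterSystem.alternatingWord j i (orderOf (s i * s j))).map (FreeAlgebra.ι ℝ)).prod)
  | quadratic (i : B) : HeckeRel s q
      (FreeAlgebra.ι ℝ i * FreeAlgebra.ι ℝ i)
      ((q - 1) • FreeAlgebra.ι ℝ i + q • (1 : FreeAlgebra ℝ B))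

/-- The Hecke algebra over `ℝ` with parameter `q` of the group `W` with distinguished involutive
generators `s i`, `i : B`, given by generators and relations. -/
abbrev HeckeAlgebra {B W : Type*} [Group W] (s : B → W) (q : ℝ) : Type _ :=
  RingQuot (HeckeRel s q)

/-- The generator `H_i` of the Hecke algebra. -/
def heckeGen {B W : Type*} [Group W] (s : B → W) (q : ℝ) (i : B) : HeckeAlgebra s q :=
  RingQuot.mkAlgHom ℝ (HeckeRel s q) (FreeAlgebra.ι ℝ i)

/-- `H` is the standard basis of the Hecke algebra: every `w` has a reduced expression, and
`H w = H_{i₁} ⋯ H_{iₖ}` for each reduced expression `i₁ ⋯ iₖ` of `w`. -/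
def IsStandardBasis {B W : Type*} [Group W] (s : B → W) (q : ℝ)
    (H : Module.Basis W ℝ (HeckeAlgebra s q)) : Prop :=
  ∀ w : W, (∃ ω : List B, IsReducedExpression s ω w) ∧
    ∀ ω : List B, IsReducedExpression s ω w → H w = (ω.map (heckeGen s q)).prod

/-! ### Weyl groups -/

/-- The simple reflections of the Weyl group of a root system with respect to a base. -/
def simpleReflection {ι V V' : Type*} [AddCommGroup V] [Module ℝ V] [AddCommGroup V'] [Module ℝ V']
    {P : RootPairing ι ℝ V V'} (b : P.Base) (i : b.support) : P.weylGroup :=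
  RootPairing.weylGroup.ofIdx P i

end

/-! The Weyl group enters only through `IsDescentRel`: involutive generators and a predicate `D w
i`, flipped by right multiplication by `s i` and unchanged by left multiplication by `s j` unless `s
j * w = w * s i`. For root systems it says that `w` makes the `i`-th simple root negative; the last
axiom holds because a simple reflection permutes the other positive roots. The axioms give the
exchange condition and Matsumoto's theorem, so `H_w` is well defined, and the quadratic relation
shows that the `H_w` span.

For independence, multiplication by generators is modelled on the free module over `W`. Left and
right operators commute (`leftHeckeOp_mul_rightHeckeOp`), so a product of left operators is
determined by its value at the unit vector. This yields the braid relations, hence a representation,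
and evaluation at the unit vector inverts `w ↦ H_w`.

Since `q > 1`, the left operators have nonnegative coefficients. Nothing cancels, so associativity
of the algebra becomes that of the multioperation. The inverse axioms come from `w ↦ w⁻¹`, which
exchanges left and right operators, and from the coefficient at the identity, found by induction on
a reduced word. -/

noncomputable section

open CoxeterSystem (alternatingWord alternatingWord_succ alternatingWord_succ'
  length_alternatingWord)

/-! ### Groups with a descent predicate -/

/-- The length of `w` with respect to the family `s` of generators. -/
def wordLength {B W : Type*} [Group W] (s : B → W) (w : W) : ℕ :=
  sInf {n | ∃ ω : List B, ω.length = n ∧ (ω.map s).prod = w}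

/-- `D w i` behaves like the relation "`i` is a right descent of `w`" for the family `s` of
involutive generators of `W`. -/
structure IsDescentRel {B W : Type*} [Group W] (s : B → W) (D : W → B → Prop) : Prop where
  mul_self : ∀ i, s i * s i = 1
  exists_word : ∀ w, ∃ ω : List B, (ω.map s).prod = w
  not_one : ∀ i, ¬ D 1 i
  mul_right_iff : ∀ w i, D (w * s i) i ↔ ¬ D w i
  mul_left_iff : ∀ w i j, s j * w ≠ w * s i → (D (s j * w) i ↔ D w i)

/-- The word `ω` has minimal length among the words with the same product. -/
def IsReducedWord {B W : Type*} [Group W] (s : B → W) (ω : List B) : Prop :=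
  wordLength s (ω.map s).prod = ω.length

lemma wordLength_prod_le {B W : Type*} [Group W] (s : B → W) (ω : List B) :
    wordLength s (ω.map s).prod ≤ ω.length :=
  Nat.sInf_le ⟨ω, rfl, rfl⟩

lemma wordLength_generator_le {B W : Type*} [Group W] (s : B → W) (i : B) :
    wordLength s (s i) ≤ 1 := by
  simpa using wordLength_prod_le s [i]

lemma prod_map_alternatingWord_succ {B M : Type*} [Monoid M] (f : B → M) (i j : B) (k : ℕ) :
    ((alternatingWord i j (k + 1)).map f).prod = ((alternatingWord j i k).map f).prod * f j := by
  simp [alternatingWord_succ]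

namespace IsDescentRel

variable {B W : Type*} [Group W] {s : B → W} {D : W → B → Prop} (h : IsDescentRel s D)
include h

lemma inv_eq (i : B) : (s i)⁻¹ = s i := inv_eq_of_mul_eq_one_left (h.mul_self i)

lemma prod_reverse (ω : List B) : (ω.reverse.map s).prod = (ω.map s).prod⁻¹ := by
  rw [List.prod_inv_reverse, List.map_reverse, List.map_map]
  congr 3
  funext i
  exact (h.inv_eq i).symm

lemma exists_isReducedWord (w : W) : ∃ ω : List B, IsReducedWord s ω ∧ (ω.map s).prod = w := by
  have hne : {n | ∃ ω : List B, ω.length = n ∧ (ω.map s).prod = w}.Nonempty := by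
    obtain ⟨ω, hω⟩ := h.exists_word w
    exact ⟨_, ω, rfl, hω⟩
  obtain ⟨ω, h1, h2⟩ := Nat.sInf_mem hne
  refine ⟨ω, ?_, h2⟩
  rw [IsReducedWord, h2, h1, wordLength]

lemma isReducedExpression_iff (ω : List B) (w : W) :
    IsReducedExpression s ω w ↔ IsReducedWord s ω ∧ (ω.map s).prod = w := by
  constructor
  · rintro ⟨rfl, h2⟩
    obtain ⟨ω', h3, h4⟩ := h.exists_isReducedWord (ω.map s).prod
    refine ⟨le_antisymm (wordLength_prod_le s ω) ?_, rfl⟩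
    rw [← h4, h3]
    exact h2 ω' h4
  · rintro ⟨h1, rfl⟩
    refine ⟨rfl, fun ω' h' ↦ ?_⟩
    rw [← h1, ← h']
    exact wordLength_prod_le s ω'

lemma wordLength_mul_le (v w : W) : wordLength s (v * w) ≤ wordLength s v + wordLength s w := by
  obtain ⟨ν, h1, rfl⟩ := h.exists_isReducedWord v
  obtain ⟨ω, h2, rfl⟩ := h.exists_isReducedWord w
  rw [h1, h2, ← List.prod_append, ← List.map_append, ← List.length_append]
  exact wordLength_prod_le s _

lemma wordLength_inv_le (w : W) : wordLength s w⁻¹ ≤ wordLength s w := by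
  obtain ⟨ω, h1, rfl⟩ := h.exists_isReducedWord w
  rw [h1, ← h.prod_reverse, ← List.length_reverse]
  exact wordLength_prod_le s _

lemma wordLength_inv (w : W) : wordLength s w⁻¹ = wordLength s w :=
  le_antisymm (h.wordLength_inv_le w) (by simpa using h.wordLength_inv_le w⁻¹)

lemma isReducedWord_reverse {ω : List B} (hω : IsReducedWord s ω) :
    IsReducedWord s ω.reverse := by
  rw [IsReducedWord, h.prod_reverse, h.wordLength_inv, hω, List.length_reverse]

/-- The exchange condition, relative to a right factor `u`. -/
lemma exchange {u : W} {i : B} (hu : ¬ D u i) : ∀ ν : List B, D ((ν.map s).prod * u) i →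
    ∃ ν' : List B, ν'.length + 1 = ν.length ∧
      (ν.map s).prod * u * s i = (ν'.map s).prod * u
  | [], h1 => (hu (by simpa using h1)).elim
  | j :: ν, h1 => by
    by_cases h2 : D ((ν.map s).prod * u) i
    · obtain ⟨ν', h3, h4⟩ := exchange hu ν h2
      exact ⟨j :: ν', by simpa using h3, by
        simp only [List.map_cons, List.prod_cons, mul_assoc] at h4 ⊢; rw [h4]⟩
    -- The descent first appears at the letter `j`. Only `s j * x = x * s i` permits this, so
    -- multiplying by `s i` deletes that letter.
    · refine ⟨ν, rfl, ?_⟩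
      rw [List.map_cons, List.prod_cons, mul_assoc] at h1
      have h3 : s j * ((ν.map s).prod * u) = (ν.map s).prod * u * s i := by
        by_contra h3
        exact h2 ((h.mul_left_iff _ _ _ h3).1 h1)
      rw [List.map_cons, List.prod_cons, mul_assoc (s j), h3, mul_assoc, h.mul_self, mul_one]

lemma wordLength_mul_lt {w : W} {i : B} (hw : D w i) :
    wordLength s (w * s i) < wordLength s w := by
  obtain ⟨ω, h1, rfl⟩ := h.exists_isReducedWord w
  obtain ⟨ω', h2, h3⟩ := h.exchange (h.not_one i) ω (by simpa using hw)
  simp only [mul_one] at h3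
  rw [h1, h3]
  exact (wordLength_prod_le s ω').trans_lt (by omega)

lemma wordLength_mul_of_not {w : W} {i : B} (hw : ¬ D w i) :
    wordLength s (w * s i) = wordLength s w + 1 := by
  have h1 := h.wordLength_mul_lt ((h.mul_right_iff w i).2 hw)
  rw [mul_assoc, h.mul_self, mul_one] at h1
  have h2 := h.wordLength_mul_le w (s i)
  have h3 := wordLength_generator_le s i
  omega

/-- The axioms on `D` are one-sided; length is invariant under inversion, which makes left descents
accessible. -/
lemma iff_wordLength (w : W) (i : B) : D w i ↔ wordLength s (w * s i) < wordLength s w := by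
  refine ⟨h.wordLength_mul_lt, fun h1 ↦ ?_⟩
  by_contra h2
  have := h.wordLength_mul_of_not h2
  omega

lemma inv_iff_wordLength (w : W) (i : B) :
    D w⁻¹ i ↔ wordLength s (s i * w) < wordLength s w := by
  rw [h.iff_wordLength, h.wordLength_inv, ← h.wordLength_inv (s i * w), mul_inv_rev, h.inv_eq]

lemma inv_mul_left_iff (w : W) (i : B) : D (s i * w)⁻¹ i ↔ ¬ D w⁻¹ i := by
  rw [mul_inv_rev, h.inv_eq, h.mul_right_iff]

lemma inv_mul_right_iff {w : W} {i j : B} (hw : s i * w ≠ w * s j) :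
    D (w * s j)⁻¹ i ↔ D w⁻¹ i := by
  rw [mul_inv_rev, h.inv_eq, h.mul_left_iff]
  intro h1
  apply hw
  have := congrArg (·⁻¹) h1
  simp only [mul_inv_rev, inv_inv, h.inv_eq] at this
  exact this.symm

lemma iff_inv_of_mul_eq {w : W} {i j : B} (hw : s i * w = w * s j) : D w j ↔ D w⁻¹ i := by
  rw [h.iff_wordLength, h.inv_iff_wordLength, hw]

lemma isReducedWord_append_singleton_iff (ω : List B) (i : B) :
    IsReducedWord s (ω ++ [i]) ↔ IsReducedWord s ω ∧ ¬ D (ω.map s).prod i := by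
  have h1 := wordLength_prod_le s ω
  have h2 := h.wordLength_mul_le (ω.map s).prod (s i)
  have h3 := wordLength_generator_le s i
  simp only [IsReducedWord, List.map_append, List.prod_append, List.map_singleton,
    List.prod_singleton, List.length_append, List.length_singleton]
  constructor
  · refine fun h4 ↦ ⟨by omega, fun h5 ↦ ?_⟩
    have := h.wordLength_mul_lt h5
    omega
  · rintro ⟨h4, h5⟩
    rw [h.wordLength_mul_of_not h5, h4]

lemma isReducedWord_cons_iff (ω : List B) (i : B) :
    IsReducedWord s (i :: ω) ↔ IsReducedWord s ω ∧ ¬ D (ω.map s).prod⁻¹ i := by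
  have key : ∀ ω : List B, IsReducedWord s ω ↔ IsReducedWord s ω.reverse := fun ω ↦
    ⟨h.isReducedWord_reverse, fun h1 ↦ by simpa using h.isReducedWord_reverse h1⟩
  rw [key, List.reverse_cons, h.isReducedWord_append_singleton_iff, ← key, h.prod_reverse]

/-! ### Alternating words and Matsumoto's theorem -/

lemma inv_prod_alternatingWord_mul (i j : B) (k : ℕ) :
    ((alternatingWord j i k).map s).prod⁻¹ * ((alternatingWord i j k).map s).prod =
      (s i * s j) ^ k := by
  induction k generalizing i j with
  | zero => simp [alternatingWord]
  | succ k ih =>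
    rw [prod_map_alternatingWord_succ, prod_map_alternatingWord_succ, mul_inv_rev, h.inv_eq,
      mul_assoc, ← mul_assoc _ _ (s j), ih j i]
    clear ih
    induction k with
    | zero => simp
    | succ k ih => rw [pow_succ', pow_succ' (s i * s j), ← ih]; simp only [mul_assoc]

/-- Prepending a letter could make `j` a descent only if the two alternating products of length `k +
1` agreed, and their quotient is `(s i * s j) ^ (k + 1)`. -/
lemma not_prod_alternatingWord {i j : B} {k : ℕ}
    (hk : ∀ t, 0 < t → t ≤ k → (s i * s j) ^ t ≠ 1) :
    ¬ D ((alternatingWord j i k).map s).prod j := by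
  induction k with
  | zero => simpa [alternatingWord] using h.not_one j
  | succ k ih =>
    have h1 := ih fun t h1 h2 ↦ hk t h1 (by omega)
    have h2 : ((alternatingWord i j (k + 1)).map s).prod ≠
        ((alternatingWord j i (k + 1)).map s).prod := by
      intro h2
      refine hk (k + 1) (by omega) le_rfl ?_
      rw [← h.inv_prod_alternatingWord_mul, h2, inv_mul_cancel]
    rw [prod_map_alternatingWord_succ] at h2
    rw [alternatingWord_succ', List.map_cons, List.prod_cons] at h2 ⊢
    rwa [h.mul_left_iff _ _ _ h2.symm]

lemma pow_ne_one_swap {i j : B} {k : ℕ} (hk : ∀ t, 0 < t → t < k → (s i * s j) ^ t ≠ 1) :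
    ∀ t, 0 < t → t < k → (s j * s i) ^ t ≠ 1 := by
  intro t h1 h2 h3
  refine hk t h1 h2 ?_
  rw [← inv_inj, ← inv_pow, mul_inv_rev, h.inv_eq, h.inv_eq, h3, inv_one]

lemma isReducedWord_alternatingWord {i j : B} {k : ℕ}
    (hk : ∀ t, 0 < t → t < k → (s i * s j) ^ t ≠ 1) : IsReducedWord s (alternatingWord i j k) := by
  induction k generalizing i j with
  | zero =>
    have := wordLength_prod_le s ([] : List B)
    simpa [alternatingWord, IsReducedWord] using this
  | succ k ih =>
    rw [alternatingWord_succ, List.concat_eq_append, h.isReducedWord_append_singleton_iff]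
    exact ⟨ih (h.pow_ne_one_swap fun t h1 h2 ↦ hk t h1 (by omega)),
      h.not_prod_alternatingWord fun t h1 h2 ↦ hk t h1 (by omega)⟩

lemma prod_alternatingWord_orderOf (i j : B) :
    ((alternatingWord i j (orderOf (s i * s j))).map s).prod =
      ((alternatingWord j i (orderOf (s i * s j))).map s).prod := by
  have := h.inv_prod_alternatingWord_mul i j (orderOf (s i * s j))
  rw [pow_orderOf_eq_one, inv_mul_eq_one] at this
  exact this.symm

/-- Split off an alternating suffix ending in `i`. Since `j` is a descent of `w` but not of the
suffix, exchange deletes a letter from the prefix and appends `j` to the suffix. -/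
lemma exists_eq_mul_alternatingWord {w : W} {i j : B} (hi : D w i) (hj : D w j) {k : ℕ}
    (hk : ∀ t, 0 < t → t < k → (s i * s j) ^ t ≠ 1) :
    ∃ v, w = v * ((alternatingWord i j k).map s).prod ∧ wordLength s w = wordLength s v + k := by
  induction k generalizing i j with
  | zero => exact ⟨w, by simp [alternatingWord], by simp⟩
  | succ k ih =>
    obtain ⟨v, h1, h2⟩ := ih hj hi (h.pow_ne_one_swap fun t h1 h2 ↦ hk t h1 (by omega))
    obtain ⟨ν, h3, rfl⟩ := h.exists_isReducedWord v
    have h4 : ¬ D ((alternatingWord j i k).map s).prod j :=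
      h.not_prod_alternatingWord fun t h1 h2 ↦ hk t h1 (by omega)
    obtain ⟨ν', h5, h6⟩ := h.exchange h4 ν (h1 ▸ hj)
    have h7 : w = (ν'.map s).prod * ((alternatingWord i j (k + 1)).map s).prod := by
      rw [prod_map_alternatingWord_succ, ← mul_assoc, ← h6, ← h1, mul_assoc, h.mul_self, mul_one]
    refine ⟨_, h7, ?_⟩
    have h8 := h.wordLength_mul_le (ν'.map s).prod ((alternatingWord i j (k + 1)).map s).prod
    have h9 := wordLength_prod_le s (alternatingWord i j (k + 1))
    have h10 := wordLength_prod_le s ν'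
    rw [← h7] at h8
    rw [length_alternatingWord] at h9
    rw [h3] at h2
    omega

/-- **Matsumoto's theorem**: a map to a monoid that respects the braid relations takes the same
value on any two reduced words for the same element. -/
theorem prod_map_eq_of_isReducedWord {M : Type*} [Monoid M] {f : B → M}
    (hf : ∀ i j, ((alternatingWord i j (orderOf (s i * s j))).map f).prod =
      ((alternatingWord j i (orderOf (s i * s j))).map f).prod) {ω ω' : List B}
    (hω : IsReducedWord s ω) (hω' : IsReducedWord s ω') (hp : (ω.map s).prod = (ω'.map s).prod) :
    (ω.map f).prod = (ω'.map f).prod := by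
  induction hn : ω.length generalizing ω ω' with
  | zero =>
    have h1 : ω'.length = 0 := by rw [← hω', ← hp, hω, hn]
    rw [List.length_eq_zero_iff] at hn h1
    rw [hn, h1]
  | succ n ih =>
    have hn' : ω'.length = n + 1 := by rw [← hω', ← hp, hω, hn]
    have same : ∀ (α β : List B) (i : B), IsReducedWord s (α ++ [i]) → IsReducedWord s (β ++ [i]) →
        ((α ++ [i]).map s).prod = ((β ++ [i]).map s).prod → (α ++ [i]).length = n + 1 →
        ((α ++ [i]).map f).prod = ((β ++ [i]).map f).prod := by
      intro α β i hα hβ hp hl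
      simp only [List.map_append, List.prod_append, List.map_singleton, List.prod_singleton,
        mul_left_inj] at hp ⊢
      rw [ih ((h.isReducedWord_append_singleton_iff _ _).1 hα).1
        ((h.isReducedWord_append_singleton_iff _ _).1 hβ).1 hp (by simpa using hl)]
    have last : ∀ {α : List B}, α.length = n + 1 → ∃ β i, α = β ++ [i] := fun {α} hα ↦
      ⟨α.dropLast, α.getLast (by rintro rfl; simp at hα), (List.dropLast_append_getLast _).symm⟩
    have desc : ∀ (α : List B) (i : B), IsReducedWord s (α ++ [i]) →
        D ((α ++ [i]).map s).prod i := by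
      intro α i hα
      simpa [h.mul_right_iff] using ((h.isReducedWord_append_singleton_iff _ _).1 hα).2
    obtain ⟨α, i, rfl⟩ := last hn
    obtain ⟨β, j, rfl⟩ := last hn'
    have hi := desc α i hω
    have hj := desc β j hω'
    rw [← hp] at hj
    rcases Nat.eq_zero_or_pos (orderOf (s i * s j)) with h0 | h0
    -- `orderOf` is `0` for infinite order; an alternating suffix of length `n + 2` would then
    -- exceed the length `n + 1` of the element.
    · rw [orderOf_eq_zero_iff'] at h0
      obtain ⟨v, -, h2⟩ := h.exists_eq_mul_alternatingWord hi hj (k := n + 2)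
        fun t h1 _ ↦ h0 t h1
      rw [hω, hn] at h2
      omega
    · have hm : ∀ t, 0 < t → t < orderOf (s i * s j) → (s i * s j) ^ t ≠ 1 :=
        fun t h1 h2 ↦ pow_ne_one_of_lt_orderOf h1.ne' h2
      have hb := hf i j
      have hs := h.prod_alternatingWord_orderOf i j
      obtain ⟨v, h1, h2⟩ := h.exists_eq_mul_alternatingWord hi hj hm
      obtain ⟨ξ, h3, rfl⟩ := h.exists_isReducedWord v
      obtain ⟨m, hm'⟩ := Nat.exists_eq_add_of_lt h0
      simp only [zero_add] at hm'
      rw [hm'] at hb hs h1 h2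
      rw [hω, h3, hn] at h2
      -- Two intermediate words, ending in `i` and in `j` and differing by one braid move, join the
      -- given words; the outer links share a last letter.
      have ei : ξ ++ alternatingWord j i (m + 1) = (ξ ++ alternatingWord i j m) ++ [i] := by
        simp [alternatingWord_succ]
      have ej : ξ ++ alternatingWord i j (m + 1) = (ξ ++ alternatingWord j i m) ++ [j] := by
        simp [alternatingWord_succ]
      have pj : ((ξ ++ alternatingWord i j (m + 1)).map s).prod = ((α ++ [i]).map s).prod := by
        rw [h1, List.map_append, List.prod_append]
      have pi : ((ξ ++ alternatingWord j i (m + 1)).map s).prod = ((α ++ [i]).map s).prod := by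
        rw [h1, List.map_append, List.prod_append, hs]
      have ri : IsReducedWord s (ξ ++ alternatingWord j i (m + 1)) := by
        rw [IsReducedWord, pi, hω, hn, List.length_append, length_alternatingWord, h2]
      have rj : IsReducedWord s (ξ ++ alternatingWord i j (m + 1)) := by
        rw [IsReducedWord, pj, hω, hn, List.length_append, length_alternatingWord, h2]
      calc ((α ++ [i]).map f).prod
          = ((ξ ++ alternatingWord j i (m + 1)).map f).prod := by
            rw [ei] at ri pi ⊢
            exact same _ _ _ hω ri pi.symm hn
        _ = ((ξ ++ alternatingWord i j (m + 1)).map f).prod := by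
            rw [List.map_append, List.prod_append, List.map_append, List.prod_append, hb]
        _ = ((β ++ [j]).map f).prod := by
            rw [ej] at rj pj ⊢
            exact (same _ _ _ hω' rj (hp.symm.trans pj.symm) hn').symm

end IsDescentRel

/-! ### The regular representation of the Hecke algebra -/

lemma linearMap_ext_single {W E : Type*} [AddCommMonoid E] [Module ℝ E] {f g : (W →₀ ℝ) →ₗ[ℝ] E}
    (h : ∀ w, f (Finsupp.single w 1) = g (Finsupp.single w 1)) : f = g := by
  ext w
  simpa using h w

section Operators

variable {B W : Type*} [Group W] (s : B → W) (D : W → B → Prop) (q : ℝ)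

open Classical in
/-- Left multiplication by the generator `H_i`, in terms of the standard basis. -/
def leftHeckeOp (i : B) : Module.End ℝ (W →₀ ℝ) :=
  Finsupp.linearCombination ℝ fun w ↦
    if D w⁻¹ i then (q - 1) • Finsupp.single w 1 + q • Finsupp.single (s i * w) 1
    else Finsupp.single (s i * w) 1

open Classical in
/-- Right multiplication by the generator `H_i`, in terms of the standard basis. -/
def rightHeckeOp (i : B) : Module.End ℝ (W →₀ ℝ) :=
  Finsupp.linearCombination ℝ fun w ↦
    if D w i then (q - 1) • Finsupp.single w 1 + q • Finsupp.single (w * s i) 1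
    else Finsupp.single (w * s i) 1

/-- The linear involution sending `H_w` to `H_{w⁻¹}`, in terms of the standard basis. -/
def invHeckeOp (W : Type*) [Group W] : Module.End ℝ (W →₀ ℝ) :=
  Finsupp.lmapDomain ℝ ℝ (fun w : W ↦ w⁻¹)

lemma invHeckeOp_single (w : W) (c : ℝ) :
    invHeckeOp W (Finsupp.single w c) = Finsupp.single w⁻¹ c := by
  simp [invHeckeOp]

lemma invHeckeOp_apply_inv (v : W →₀ ℝ) (w : W) : invHeckeOp W v w⁻¹ = v w :=
  Finsupp.mapDomain_apply inv_injective v w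

lemma leftHeckeOp_single_of_pos {i : B} {w : W} (h : D w⁻¹ i) :
    leftHeckeOp s D q i (Finsupp.single w 1) =
      (q - 1) • Finsupp.single w 1 + q • Finsupp.single (s i * w) 1 := by
  simp [leftHeckeOp, h]

lemma leftHeckeOp_single_of_neg {i : B} {w : W} (h : ¬ D w⁻¹ i) :
    leftHeckeOp s D q i (Finsupp.single w 1) = Finsupp.single (s i * w) 1 := by
  simp [leftHeckeOp, h]

lemma rightHeckeOp_single_of_pos {i : B} {w : W} (h : D w i) :
    rightHeckeOp s D q i (Finsupp.single w 1) =
      (q - 1) • Finsupp.single w 1 + q • Finsupp.single (w * s i) 1 := by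
  simp [rightHeckeOp, h]

lemma rightHeckeOp_single_of_neg {i : B} {w : W} (h : ¬ D w i) :
    rightHeckeOp s D q i (Finsupp.single w 1) = Finsupp.single (w * s i) 1 := by
  simp [rightHeckeOp, h]

lemma leftHeckeOp_nonneg (hq : 1 < q) (i : B) {v : W →₀ ℝ} (hv : 0 ≤ v) :
    0 ≤ leftHeckeOp s D q i v := by
  rw [leftHeckeOp, Finsupp.linearCombination_apply]
  refine Finset.sum_nonneg fun w _ ↦ smul_nonneg (hv w) ?_
  have h1 : ∀ w : W, (0 : W →₀ ℝ) ≤ Finsupp.single w 1 :=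
    fun w ↦ Finsupp.single_nonneg.2 zero_le_one
  split_ifs
  · exact add_nonneg (smul_nonneg (by linarith) (h1 _)) (smul_nonneg (by linarith) (h1 _))
  · exact h1 _

lemma prod_leftHeckeOp_nonneg (hq : 1 < q) (ω : List B) {v : W →₀ ℝ} (hv : 0 ≤ v) :
    0 ≤ (ω.map (leftHeckeOp s D q)).prod v := by
  induction ω with
  | nil => simpa using hv
  | cons i ω ih => simpa using leftHeckeOp_nonneg s D q hq i ih

end Operators

namespace IsDescentRel

variable {B W : Type*} [Group W] {s : B → W} {D : W → B → Prop} (h : IsDescentRel s D) (q : ℝ)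
include h

lemma mul_mul_cancel_left (i : B) (w : W) : s i * (s i * w) = w := by
  rw [← mul_assoc, h.mul_self, one_mul]

lemma leftHeckeOp_mul_self (i : B) :
    leftHeckeOp s D q i * leftHeckeOp s D q i = (q - 1) • leftHeckeOp s D q i + q • 1 := by
  refine linearMap_ext_single fun w ↦ ?_
  simp only [Module.End.mul_apply, LinearMap.add_apply, LinearMap.smul_apply, Module.End.one_apply]
  have h1 := h.inv_mul_left_iff w i
  by_cases hw : D w⁻¹ i
  · rw [leftHeckeOp_single_of_pos s D q hw, map_add, map_smul, map_smul,
      leftHeckeOp_single_of_pos s D q hw, leftHeckeOp_single_of_neg s D q (by tauto),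
      h.mul_mul_cancel_left]
  · rw [leftHeckeOp_single_of_neg s D q hw, leftHeckeOp_single_of_pos s D q (by tauto),
      h.mul_mul_cancel_left]

/-- If `s i * w ≠ w * s j`, neither multiplication affects the other's descent condition. Otherwise
the two operators agree at `w` and at `w * s j`, whose span is stable under both. -/
lemma leftHeckeOp_mul_rightHeckeOp (i j : B) :
    leftHeckeOp s D q i * rightHeckeOp s D q j = rightHeckeOp s D q j * leftHeckeOp s D q i := by
  refine linearMap_ext_single fun w ↦ ?_
  simp only [Module.End.mul_apply]
  by_cases hw : s i * w = w * s j
  · have h1 := h.iff_inv_of_mul_eq hw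
    have h2 : leftHeckeOp s D q i (Finsupp.single w 1) =
        rightHeckeOp s D q j (Finsupp.single w 1) := by
      by_cases h3 : D w j
      · rw [leftHeckeOp_single_of_pos s D q (h1.1 h3), rightHeckeOp_single_of_pos s D q h3, hw]
      · rw [leftHeckeOp_single_of_neg s D q (mt h1.2 h3), rightHeckeOp_single_of_neg s D q h3, hw]
    have hw' : s i * (w * s j) = w * s j * s j := by rw [← mul_assoc, hw]
    have h3 : leftHeckeOp s D q i (Finsupp.single (w * s j) 1) =
        rightHeckeOp s D q j (Finsupp.single (w * s j) 1) := by
      have h1 := h.iff_inv_of_mul_eq hw'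
      by_cases h3 : D (w * s j) j
      · rw [leftHeckeOp_single_of_pos s D q (h1.1 h3), rightHeckeOp_single_of_pos s D q h3, hw']
      · rw [leftHeckeOp_single_of_neg s D q (mt h1.2 h3), rightHeckeOp_single_of_neg s D q h3, hw']
    rw [h2]
    by_cases h4 : D w j
    · rw [rightHeckeOp_single_of_pos s D q h4]
      simp only [map_add, map_smul, h2, h3]
    · rw [rightHeckeOp_single_of_neg s D q h4, h3]
  · have hr := h.mul_left_iff w j i hw
    have hl := h.inv_mul_right_iff hw
    by_cases h1 : D w j <;> by_cases h2 : D w⁻¹ i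
    · rw [rightHeckeOp_single_of_pos s D q h1, leftHeckeOp_single_of_pos s D q h2]
      simp only [map_add, map_smul]
      rw [leftHeckeOp_single_of_pos s D q h2, leftHeckeOp_single_of_pos s D q (hl.2 h2),
        rightHeckeOp_single_of_pos s D q h1, rightHeckeOp_single_of_pos s D q (hr.2 h1), mul_assoc]
      module
    · rw [rightHeckeOp_single_of_pos s D q h1, leftHeckeOp_single_of_neg s D q h2]
      simp only [map_add, map_smul]
      rw [leftHeckeOp_single_of_neg s D q h2, leftHeckeOp_single_of_neg s D q (mt hl.1 h2),
        rightHeckeOp_single_of_pos s D q (hr.2 h1), mul_assoc]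
    · rw [rightHeckeOp_single_of_neg s D q h1, leftHeckeOp_single_of_pos s D q h2]
      simp only [map_add, map_smul]
      rw [leftHeckeOp_single_of_pos s D q (hl.2 h2),
        rightHeckeOp_single_of_neg s D q h1, rightHeckeOp_single_of_neg s D q (mt hr.1 h1),
        mul_assoc]
    · rw [rightHeckeOp_single_of_neg s D q h1, leftHeckeOp_single_of_neg s D q h2,
        leftHeckeOp_single_of_neg s D q (mt hl.1 h2),
        rightHeckeOp_single_of_neg s D q (mt hr.1 h1), mul_assoc]

lemma invHeckeOp_mul_leftHeckeOp (i : B) :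
    invHeckeOp W * leftHeckeOp s D q i = rightHeckeOp s D q i * invHeckeOp W := by
  refine linearMap_ext_single fun w ↦ ?_
  simp only [Module.End.mul_apply, invHeckeOp_single]
  by_cases hw : D w⁻¹ i
  · rw [leftHeckeOp_single_of_pos s D q hw, rightHeckeOp_single_of_pos s D q hw]
    simp only [map_add, map_smul, invHeckeOp_single, mul_inv_rev, h.inv_eq]
  · rw [leftHeckeOp_single_of_neg s D q hw, rightHeckeOp_single_of_neg s D q hw,
      invHeckeOp_single, mul_inv_rev, h.inv_eq]

lemma invHeckeOp_prod_leftHeckeOp (ω : List B) (v : W →₀ ℝ) :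
    invHeckeOp W ((ω.map (leftHeckeOp s D q)).prod v) =
      (ω.map (rightHeckeOp s D q)).prod (invHeckeOp W v) := by
  induction ω generalizing v with
  | nil => simp
  | cons i ω ih =>
    have := LinearMap.congr_fun (h.invHeckeOp_mul_leftHeckeOp q i)
      ((ω.map (leftHeckeOp s D q)).prod v)
    simp only [Module.End.mul_apply] at this
    simp only [List.map_cons, List.prod_cons, Module.End.mul_apply]
    rw [this, ih]

lemma prod_leftHeckeOp_single_one {ω : List B} (hω : IsReducedWord s ω) :
    (ω.map (leftHeckeOp s D q)).prod (Finsupp.single 1 1) =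
      Finsupp.single (ω.map s).prod 1 := by
  induction ω with
  | nil => simp
  | cons i ω ih =>
    obtain ⟨h1, h2⟩ := (h.isReducedWord_cons_iff ω i).1 hω
    simp [ih h1, leftHeckeOp_single_of_neg s D q h2]

lemma prod_rightHeckeOp_single_one {ω : List B} (hω : IsReducedWord s ω) :
    (ω.reverse.map (rightHeckeOp s D q)).prod (Finsupp.single 1 1) =
      Finsupp.single (ω.map s).prod 1 := by
  have := h.invHeckeOp_prod_leftHeckeOp q ω.reverse (Finsupp.single 1 1)
  rw [h.prod_leftHeckeOp_single_one q (h.isReducedWord_reverse hω), invHeckeOp_single,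
    invHeckeOp_single, h.prod_reverse, inv_inv, inv_one] at this
  exact this.symm

lemma commute_prod_leftHeckeOp (ω : List B) (j : B) :
    Commute (ω.map (leftHeckeOp s D q)).prod (rightHeckeOp s D q j) := by
  refine Commute.list_prod_left _ _ fun x hx ↦ ?_
  obtain ⟨i, -, rfl⟩ := List.mem_map.1 hx
  exact h.leftHeckeOp_mul_rightHeckeOp q i j

lemma commute_prod_leftHeckeOp_prod_rightHeckeOp (ω ν : List B) :
    Commute (ω.map (leftHeckeOp s D q)).prod (ν.map (rightHeckeOp s D q)).prod := by
  refine Commute.list_prod_right _ _ fun x hx ↦ ?_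
  obtain ⟨j, -, rfl⟩ := List.mem_map.1 hx
  exact h.commute_prod_leftHeckeOp q ω j

/-- A product of left operators is determined by its value at the unit. -/
lemma prod_leftHeckeOp_ext {ω ω' : List B}
    (h1 : (ω.map (leftHeckeOp s D q)).prod (Finsupp.single 1 1) =
      (ω'.map (leftHeckeOp s D q)).prod (Finsupp.single 1 1)) :
    (ω.map (leftHeckeOp s D q)).prod = (ω'.map (leftHeckeOp s D q)).prod := by
  refine linearMap_ext_single fun w ↦ ?_
  obtain ⟨ν, h2, rfl⟩ := h.exists_isReducedWord w
  rw [← h.prod_rightHeckeOp_single_one q h2, ← Module.End.mul_apply, ← Module.End.mul_apply,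
    (h.commute_prod_leftHeckeOp_prod_rightHeckeOp q ω _).eq,
    (h.commute_prod_leftHeckeOp_prod_rightHeckeOp q ω' _).eq, Module.End.mul_apply, h1,
    Module.End.mul_apply]

/-- Both sides come from reduced words of one element, so they agree at the unit vector, which
suffices by `prod_leftHeckeOp_ext`. -/
lemma leftHeckeOp_braid (i j : B) :
    ((alternatingWord i j (orderOf (s i * s j))).map (leftHeckeOp s D q)).prod =
      ((alternatingWord j i (orderOf (s i * s j))).map (leftHeckeOp s D q)).prod := by
  have hm : ∀ t, 0 < t → t < orderOf (s i * s j) → (s i * s j) ^ t ≠ 1 :=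
    fun t h1 h2 ↦ pow_ne_one_of_lt_orderOf h1.ne' h2
  apply h.prod_leftHeckeOp_ext
  rw [h.prod_leftHeckeOp_single_one q (h.isReducedWord_alternatingWord hm),
    h.prod_leftHeckeOp_single_one q (h.isReducedWord_alternatingWord (h.pow_ne_one_swap hm)),
    h.prod_alternatingWord_orderOf]

/-- The regular representation of the Hecke algebra. -/
def heckeRep : HeckeAlgebra s q →ₐ[ℝ] Module.End ℝ (W →₀ ℝ) :=
  RingQuot.liftAlgHom ℝ ⟨FreeAlgebra.lift ℝ (leftHeckeOp s D q), by
    intro x y hxy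
    induction hxy with
    | braid i j =>
      simpa [map_list_prod, Function.comp_def] using h.leftHeckeOp_braid q i j
    | quadratic i => simpa using h.leftHeckeOp_mul_self q i⟩

lemma heckeRep_heckeGen (i : B) : h.heckeRep q (heckeGen s q i) = leftHeckeOp s D q i := by
  simp [heckeRep, heckeGen]

lemma heckeRep_prod (ω : List B) :
    h.heckeRep q (ω.map (heckeGen s q)).prod = (ω.map (leftHeckeOp s D q)).prod := by
  rw [map_list_prod, List.map_map]
  congr 2
  funext i
  exact h.heckeRep_heckeGen q i

end IsDescentRel

/-! ### The standard basis of the Hecke algebra -/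

section Gen

variable {B W : Type*} [Group W] (s : B → W) (q : ℝ)

lemma heckeGen_braid (i j : B) :
    ((alternatingWord i j (orderOf (s i * s j))).map (heckeGen s q)).prod =
      ((alternatingWord j i (orderOf (s i * s j))).map (heckeGen s q)).prod := by
  have := RingQuot.mkAlgHom_rel ℝ (HeckeRel.braid (s := s) (q := q) i j)
  rw [map_list_prod, map_list_prod, List.map_map, List.map_map] at this
  exact this

lemma heckeGen_mul_self (i : B) :
    heckeGen s q i * heckeGen s q i = (q - 1) • heckeGen s q i + q • 1 := by
  have := RingQuot.mkAlgHom_rel ℝ (HeckeRel.quadratic (s := s) (q := q) i)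
  rw [map_mul, map_add, map_smul, map_smul, map_one] at this
  exact this

end Gen

namespace IsDescentRel

variable {B W : Type*} [Group W] {s : B → W} {D : W → B → Prop} (h : IsDescentRel s D) (q : ℝ)
include h

/-- A chosen reduced word. -/
def reducedWord (w : W) : List B := (h.exists_isReducedWord w).choose

lemma isReducedWord_reducedWord (w : W) : IsReducedWord s (h.reducedWord w) :=
  (h.exists_isReducedWord w).choose_spec.1

lemma prod_reducedWord (w : W) : ((h.reducedWord w).map s).prod = w :=
  (h.exists_isReducedWord w).choose_spec.2

/-- The element `H_w` of the Hecke algebra. -/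
def heckeElt (w : W) : HeckeAlgebra s q := ((h.reducedWord w).map (heckeGen s q)).prod

lemma prod_heckeGen_eq_heckeElt {ω : List B} (hω : IsReducedWord s ω) :
    (ω.map (heckeGen s q)).prod = h.heckeElt q (ω.map s).prod :=
  h.prod_map_eq_of_isReducedWord (heckeGen_braid s q) hω (h.isReducedWord_reducedWord _)
    (h.prod_reducedWord _).symm

lemma heckeElt_one : h.heckeElt q 1 = 1 := by
  have h1 : IsReducedWord s ([] : List B) := by
    have := wordLength_prod_le s ([] : List B)
    simpa [IsReducedWord] using this
  simpa using (h.prod_heckeGen_eq_heckeElt q h1).symm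

lemma heckeGen_mul_heckeElt_of_not {i : B} {w : W} (hw : ¬ D w⁻¹ i) :
    heckeGen s q i * h.heckeElt q w = h.heckeElt q (s i * w) := by
  have h1 : IsReducedWord s (i :: h.reducedWord w) := by
    rw [h.isReducedWord_cons_iff, h.prod_reducedWord]
    exact ⟨h.isReducedWord_reducedWord w, hw⟩
  have h2 := h.prod_heckeGen_eq_heckeElt q h1
  rwa [List.map_cons, List.prod_cons, List.map_cons, List.prod_cons, h.prod_reducedWord] at h2

/-- Here `H_w = H_i H_{s i * w}`, so the quadratic relation applies. -/
lemma heckeGen_mul_heckeElt_of_pos {i : B} {w : W} (hw : D w⁻¹ i) :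
    heckeGen s q i * h.heckeElt q w =
      (q - 1) • h.heckeElt q w + q • h.heckeElt q (s i * w) := by
  have h1 : ¬ D (s i * w)⁻¹ i := by rw [h.inv_mul_left_iff]; exact not_not.2 hw
  have h2 := h.heckeGen_mul_heckeElt_of_not q h1
  rw [h.mul_mul_cancel_left] at h2
  rw [← h2, ← mul_assoc, heckeGen_mul_self, add_mul, smul_mul_assoc, smul_mul_assoc, one_mul]

/-- The linear map from the free module on `W` sending `w` to `H_w`. -/
def heckeLinear : (W →₀ ℝ) →ₗ[ℝ] HeckeAlgebra s q :=
  Finsupp.linearCombination ℝ (h.heckeElt q)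

lemma heckeLinear_single (w : W) : h.heckeLinear q (Finsupp.single w 1) = h.heckeElt q w := by
  simp [heckeLinear]

lemma heckeLinear_leftHeckeOp (i : B) (v : W →₀ ℝ) :
    h.heckeLinear q (leftHeckeOp s D q i v) = heckeGen s q i * h.heckeLinear q v := by
  have key : h.heckeLinear q ∘ₗ leftHeckeOp s D q i =
      LinearMap.mulLeft ℝ (heckeGen s q i) ∘ₗ h.heckeLinear q := by
    refine linearMap_ext_single fun w ↦ ?_
    simp only [LinearMap.comp_apply, LinearMap.mulLeft_apply, h.heckeLinear_single]
    by_cases hw : D w⁻¹ i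
    · rw [leftHeckeOp_single_of_pos s D q hw, map_add, map_smul, map_smul, h.heckeLinear_single,
        h.heckeLinear_single, h.heckeGen_mul_heckeElt_of_pos q hw]
    · rw [leftHeckeOp_single_of_neg s D q hw, h.heckeLinear_single,
        h.heckeGen_mul_heckeElt_of_not q hw]
  exact LinearMap.congr_fun key v

lemma heckeLinear_heckeRep (x : HeckeAlgebra s q) (v : W →₀ ℝ) :
    h.heckeLinear q (h.heckeRep q x v) = x * h.heckeLinear q v := by
  obtain ⟨a, rfl⟩ := RingQuot.mkAlgHom_surjective ℝ (HeckeRel s q) x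
  induction a using FreeAlgebra.induction generalizing v with
  | grade0 r =>
    rw [AlgHom.commutes, AlgHom.commutes, Module.algebraMap_end_apply, map_smul, Algebra.smul_def]
  | grade1 i =>
    change h.heckeLinear q (h.heckeRep q (heckeGen s q i) v) = heckeGen s q i * _
    rw [h.heckeRep_heckeGen, h.heckeLinear_leftHeckeOp]
  | mul a b ha hb => rw [map_mul, map_mul, Module.End.mul_apply, ha, hb, mul_assoc]
  | add a b ha hb => rw [map_add, map_add, LinearMap.add_apply, map_add, ha, hb, add_mul]

lemma heckeRep_heckeElt_single_one (w : W) :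
    h.heckeRep q (h.heckeElt q w) (Finsupp.single 1 1) = Finsupp.single w 1 := by
  rw [heckeElt, h.heckeRep_prod, h.prod_leftHeckeOp_single_one q (h.isReducedWord_reducedWord w),
    h.prod_reducedWord]

/-- The linear equivalence between the Hecke algebra and the free module on `W`. -/
def heckeEquiv : HeckeAlgebra s q ≃ₗ[ℝ] (W →₀ ℝ) :=
  LinearEquiv.ofLinearMap (LinearMap.applyₗ (Finsupp.single 1 1) ∘ₗ (h.heckeRep q).toLinearMap)
    (h.heckeLinear q)
    (linearMap_ext_single fun w ↦ by
      simp [h.heckeLinear_single, h.heckeRep_heckeElt_single_one])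
    (LinearMap.ext fun x ↦ by
      simp [h.heckeLinear_heckeRep, h.heckeLinear_single, h.heckeElt_one])

/-- The standard basis of the Hecke algebra. -/
def heckeBasis : Module.Basis W ℝ (HeckeAlgebra s q) := .ofRepr (h.heckeEquiv q)

lemma heckeBasis_apply (w : W) : h.heckeBasis q w = h.heckeElt q w := by
  have : h.heckeBasis q w = h.heckeLinear q (Finsupp.single w 1) := rfl
  rw [this, h.heckeLinear_single]

lemma heckeBasis_repr (x : HeckeAlgebra s q) :
    (h.heckeBasis q).repr x = h.heckeRep q x (Finsupp.single 1 1) := rfl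

lemma isStandardBasis_heckeBasis : IsStandardBasis s q (h.heckeBasis q) := by
  intro w
  simp only [h.isReducedExpression_iff]
  refine ⟨h.exists_isReducedWord w, ?_⟩
  rintro ω ⟨h1, rfl⟩
  rw [heckeBasis_apply, h.prod_heckeGen_eq_heckeElt q h1]

/-! ### Structure constants -/

lemma structureConstant_heckeBasis {ω : List B} (hω : IsReducedWord s ω) (y z : W) :
    structureConstant (h.heckeBasis q) (ω.map s).prod y z =
      (ω.map (leftHeckeOp s D q)).prod (Finsupp.single y 1) z := by
  rw [structureConstant, heckeBasis_repr, map_mul, Module.End.mul_apply, heckeBasis_apply,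
    heckeBasis_apply, heckeRep_heckeElt_single_one, ← h.prod_heckeGen_eq_heckeElt q hω,
    h.heckeRep_prod]

lemma structureConstant_heckeBasis_nonneg (hq : 1 < q) (x y z : W) :
    0 ≤ structureConstant (h.heckeBasis q) x y z := by
  obtain ⟨ω, h1, rfl⟩ := h.exists_isReducedWord x
  rw [h.structureConstant_heckeBasis q h1]
  exact prod_leftHeckeOp_nonneg s D q hq ω (Finsupp.single_nonneg.2 zero_le_one) z

/-- Building `y` by right operators from the unit and commuting them past the left operators for `x`
computes `H_x H_y` from the right; inversion then turns right operators into left ones. -/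
lemma structureConstant_heckeBasis_inv (x y z : W) :
    structureConstant (h.heckeBasis q) y⁻¹ x⁻¹ z⁻¹ = structureConstant (h.heckeBasis q) x y z := by
  obtain ⟨ω, h1, rfl⟩ := h.exists_isReducedWord x
  obtain ⟨ν, h2, rfl⟩ := h.exists_isReducedWord y
  rw [h.structureConstant_heckeBasis q h1, ← h.prod_reverse ν,
    h.structureConstant_heckeBasis q (h.isReducedWord_reverse h2),
    ← h.prod_rightHeckeOp_single_one q h2, ← Module.End.mul_apply,
    (h.commute_prod_leftHeckeOp_prod_rightHeckeOp q ω _).eq, Module.End.mul_apply,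
    h.prod_leftHeckeOp_single_one q h1]
  have h3 := h.invHeckeOp_prod_leftHeckeOp q ν.reverse (Finsupp.single (ω.map s).prod⁻¹ 1)
  rw [invHeckeOp_single, inv_inv] at h3
  rw [← h3, ← invHeckeOp_apply_inv _ z⁻¹, inv_inv]

lemma prod_leftHeckeOp_single_apply_one (hq : 1 < q) {ω : List B} (hω : IsReducedWord s ω) (y : W) :
    0 < (ω.map (leftHeckeOp s D q)).prod (Finsupp.single y 1) 1 ↔ y = (ω.map s).prod⁻¹ := by
  induction ω using List.reverseRecOn generalizing y with
  -- Induction peels letters off the end, because the last letter's operator acts first.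
  | nil =>
    classical
    by_cases hy : y = 1 <;> simp [hy]
  | append_singleton ω i ih =>
    obtain ⟨h1, h2⟩ := (h.isReducedWord_append_singleton_iff ω i).1 hω
    have h3 : y = ((ω ++ [i]).map s).prod⁻¹ ↔ s i * y = (ω.map s).prod⁻¹ := by
      simp only [List.map_append, List.prod_append, List.map_singleton, List.prod_singleton,
        mul_inv_rev, h.inv_eq]
      rw [← mul_right_inj (s i), h.mul_mul_cancel_left]
    rw [h3, ← ih h1, List.map_append, List.prod_append, Module.End.mul_apply, List.map_singleton,
      List.prod_singleton]
    by_cases h4 : D y⁻¹ i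
    · rw [leftHeckeOp_single_of_pos s D q h4]
      simp only [map_add, map_smul, Finsupp.add_apply, Finsupp.smul_apply, smul_eq_mul]
      -- The `q - 1` term drops out: otherwise `y⁻¹` is the product of `ω`, and the descent `i`
      -- contradicts reducedness of `ω ++ [i]`.
      have h5 : ¬ 0 < (ω.map (leftHeckeOp s D q)).prod (Finsupp.single y 1) 1 := by
        rw [ih h1]
        rintro rfl
        exact h2 (by simpa using h4)
      have h6 : (ω.map (leftHeckeOp s D q)).prod (Finsupp.single y 1) 1 = 0 :=
        le_antisymm (not_lt.1 h5)
          (prod_leftHeckeOp_nonneg s D q hq ω (Finsupp.single_nonneg.2 zero_le_one) 1)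
      rw [h6, mul_zero, zero_add, mul_pos_iff_of_pos_left (by linarith)]
    · rw [leftHeckeOp_single_of_neg s D q h4]

lemma structureConstant_heckeBasis_one_pos_iff (hq : 1 < q) (x y : W) :
    0 < structureConstant (h.heckeBasis q) x y 1 ↔ y = x⁻¹ := by
  obtain ⟨ω, h1, rfl⟩ := h.exists_isReducedWord x
  rw [h.structureConstant_heckeBasis q h1, h.prod_leftHeckeOp_single_apply_one q hq h1]

end IsDescentRel

/-! ### The multigroup of a basis with nonnegative structure constants -/

/-- Both unions are the set of `z` with positive coefficient in `H a * H b * H c`: a sum of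
nonnegative terms is positive exactly when some term is. -/
lemma iUnion_basisOp_assoc {S A : Type*} [Ring A] [Algebra ℝ A] (H : Module.Basis S ℝ A)
    (hH : ∀ x y z, 0 ≤ structureConstant H x y z) (a b c : S) :
    (⋃ t ∈ basisOp H b c, basisOp H a t) = ⋃ s ∈ basisOp H a b, basisOp H s c := by
  have expand : ∀ x y, H x * H y =
      ∑ t ∈ (H.repr (H x * H y)).support, structureConstant H x y t • H t := by
    intro x y
    exact (H.linearCombination_repr (H x * H y)).symm
  have mem_supp : ∀ x y t, 0 < structureConstant H x y t →
      t ∈ (H.repr (H x * H y)).support := fun x y t ht ↦ Finsupp.mem_support_iff.2 ht.ne'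
  ext z
  simp only [Set.mem_iUnion, exists_prop]
  trans 0 < H.repr (H a * H b * H c) z
  · rw [mul_assoc, expand b c]
    simp only [Finset.mul_sum, mul_smul_comm, map_sum, map_smul, Finsupp.coe_finsetSum,
      Finset.sum_apply, Finsupp.smul_apply, smul_eq_mul]
    change _ ↔ 0 < ∑ t ∈ _, structureConstant H b c t * structureConstant H a t z
    rw [Finset.sum_pos_iff_of_nonneg fun t _ ↦ mul_nonneg (hH _ _ _) (hH _ _ _)]
    constructor
    · rintro ⟨t, h1, h2⟩
      exact ⟨t, mem_supp _ _ _ h1, mul_pos h1 h2⟩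
    · rintro ⟨t, -, h1⟩
      exact ⟨t, pos_of_mul_pos_left h1 (hH _ _ _), pos_of_mul_pos_right h1 (hH _ _ _)⟩
  · rw [expand a b]
    simp only [Finset.sum_mul, smul_mul_assoc, map_sum, map_smul, Finsupp.coe_finsetSum,
      Finset.sum_apply, Finsupp.smul_apply, smul_eq_mul]
    change 0 < ∑ t ∈ _, structureConstant H a b t * structureConstant H t c z ↔ _
    rw [Finset.sum_pos_iff_of_nonneg fun t _ ↦ mul_nonneg (hH _ _ _) (hH _ _ _)]
    constructor
    · rintro ⟨t, -, h1⟩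
      exact ⟨t, pos_of_mul_pos_left h1 (hH _ _ _), pos_of_mul_pos_right h1 (hH _ _ _)⟩
    · rintro ⟨t, h1, h2⟩
      exact ⟨t, mem_supp _ _ _ h1, mul_pos h1 h2⟩

lemma IsDescentRel.isMultigroup_heckeBasis {B W : Type*} [Group W] {s : B → W}
    {D : W → B → Prop} (h : IsDescentRel s D) {q : ℝ} (hq : 1 < q) :
    IsMultigroup (basisOp (h.heckeBasis q)) 1 fun w : W ↦ w⁻¹ where
  nonempty := ⟨1⟩
  assoc := iUnion_basisOp_assoc _ (h.structureConstant_heckeBasis_nonneg q hq)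
  one_op a := by
    classical
    ext z
    simp only [basisOp, structureConstant, h.heckeBasis_apply q 1, h.heckeElt_one, one_mul,
      Module.Basis.repr_self, Finsupp.single_apply, Set.mem_ofPred_eq, Set.mem_singleton_iff]
    split_ifs with h1 <;> simp [h1, eq_comm]
  op_one a := by
    classical
    ext z
    simp only [basisOp, structureConstant, h.heckeBasis_apply q 1, h.heckeElt_one, mul_one,
      Module.Basis.repr_self, Finsupp.single_apply, Set.mem_ofPred_eq, Set.mem_singleton_iff]
    split_ifs with h1 <;> simp [h1, eq_comm]
  mem_op_right_iff a b := h.structureConstant_heckeBasis_one_pos_iff q hq a b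
  mem_op_left_iff a c := by
    rw [← inv_inv c, inv_inj, eq_comm]
    exact (h.structureConstant_heckeBasis_one_pos_iff q hq c⁻¹⁻¹ a).trans
      (by rw [inv_inv])
  mem_op_iff a b c := by
    simp only [basisOp, Set.mem_ofPred_eq, h.structureConstant_heckeBasis_inv]

/-! ### Weyl groups -/

namespace RootPairing

variable {ι V V' : Type*} [AddCommGroup V] [Module ℝ V] [AddCommGroup V'] [Module ℝ V']
  {P : RootPairing ι ℝ V V'}

lemma weylGroup.ofIdx_mul_self (i : ι) :
    weylGroup.ofIdx P i * weylGroup.ofIdx P i = 1 := by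
  apply Subtype.ext
  change Equiv.reflection P i * Equiv.reflection P i = 1
  rw [mul_eq_one_iff_inv_eq, Equiv.reflection_inv]

lemma weylGroupToPerm_ofIdx (i : ι) :
    P.weylGroupToPerm (weylGroup.ofIdx P i) = P.reflectionPerm i := by
  simp [weylGroup.ofIdx]

/-- A Weyl group element is determined by its action on the weight space. -/
lemma weylGroup_ext [P.IsRootSystem] {g g' : P.weylGroup} (h : ∀ v : V, g • v = g' • v) :
    g = g' := by
  apply Subtype.ext
  apply Equiv.weightHom_injective P
  ext v
  exact h v

lemma weylGroup_conj_ofIdx [P.IsRootSystem] (g : P.weylGroup) (i : ι) :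
    g * weylGroup.ofIdx P i * g⁻¹ = weylGroup.ofIdx P (P.weylGroupToPerm g i) := by
  rw [mul_inv_eq_iff_eq_mul]
  apply weylGroup_ext
  intro v
  have h1 : P.toLinearMap (g • v) (P.coroot (P.weylGroupToPerm g i)) =
      P.toLinearMap v (P.coroot i) := by
    refine (LinearMap.congr_fun (Hom.weight_coweight_transpose_apply P P
      (P.coroot (P.weylGroupToPerm g i)) g.1.toHom) v).trans ?_
    refine congrArg (P.toLinearMap v) ?_
    refine (Hom.coroot_coweightMap_apply _ _ _ _).trans ?_
    congr 1
    exact Equiv.symm_apply_apply _ _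
  have h2 : ∀ (k : ι) (x : V),
      weylGroup.ofIdx P k • x = x - P.toLinearMap x (P.coroot k) • P.root k :=
    fun k x ↦ P.reflection_apply k x
  rw [mul_smul, mul_smul, h2, h2, h1, ← weylGroup_apply_root, smul_sub]
  congr 1
  exact smul_comm g (P.toLinearMap v (P.coroot i)) (P.root i)

namespace Base

variable [Finite ι] [P.IsCrystallographic] [P.IsReduced] (b : P.Base)

/-- Every root is reached from simple ones by negations and simple reflections, each of which
conjugates the associated reflection. -/
lemma ofIdx_mem_closure_simpleReflection [P.IsRootSystem] (i : ι) :
    weylGroup.ofIdx P i ∈ Subgroup.closure (Set.range (simpleReflection b)) := by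
  have conj : ∀ i j : ι, weylGroup.ofIdx P (P.reflectionPerm j i) =
      weylGroup.ofIdx P j * weylGroup.ofIdx P i * (weylGroup.ofIdx P j)⁻¹ := by
    intro i j
    rw [weylGroup_conj_ofIdx, weylGroupToPerm_ofIdx]
  induction i using b.induction_reflect with
  | h₀ i hi =>
    rw [conj]
    exact mul_mem (mul_mem hi hi) (inv_mem hi)
  | h₁ i hi => exact Subgroup.subset_closure ⟨⟨i, hi⟩, rfl⟩
  | h₂ i j hi hj =>
    have hj' : weylGroup.ofIdx P j ∈ Subgroup.closure (Set.range (simpleReflection b)) :=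
      Subgroup.subset_closure ⟨⟨j, hj⟩, rfl⟩
    rw [conj]
    exact mul_mem (mul_mem hj' hi) (inv_mem hj')

lemma closure_range_simpleReflection [P.IsRootSystem] :
    Subgroup.closure (Set.range (simpleReflection b)) = ⊤ := by
  rw [eq_top_iff]
  rintro ⟨g, hg⟩ -
  induction hg using weylGroup.induction with
  | mem i => exact b.ofIdx_mem_closure_simpleReflection i
  | one => exact one_mem _
  | mul x y hx hy hx' hy' => exact mul_mem hx' hy'

lemma exists_prod_simpleReflection [P.IsRootSystem] (w : P.weylGroup) :
    ∃ ω : List b.support, (ω.map (simpleReflection b)).prod = w := by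
  have hw : w ∈ Subgroup.closure (Set.range (simpleReflection b)) := by
    rw [b.closure_range_simpleReflection]; trivial
  induction hw using Subgroup.closure_induction_right with
  | one => exact ⟨[], rfl⟩
  | mul_right x hx y hy ih =>
    obtain ⟨ω, rfl⟩ := ih
    obtain ⟨i, rfl⟩ := hy
    exact ⟨ω ++ [i], by simp⟩
  | mul_inv_cancel x hx y hy ih =>
    obtain ⟨ω, rfl⟩ := ih
    obtain ⟨i, rfl⟩ := hy
    refine ⟨ω ++ [i], ?_⟩
    have hi : (simpleReflection b i)⁻¹ = simpleReflection b i :=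
      inv_eq_of_mul_eq_one_left (weylGroup.ofIdx_mul_self (i : ι))
    rw [hi]
    simp

/-- The simple reflections of a Weyl group, with the relation "`w` sends the `i`-th simple root to
a negative root". -/
lemma isDescentRel_simpleReflection [P.IsRootSystem] :
    IsDescentRel (simpleReflection b) fun w i ↦ ¬ b.IsPos (P.weylGroupToPerm w i) where
  mul_self i := weylGroup.ofIdx_mul_self _
  exists_word := b.exists_prod_simpleReflection
  not_one i := by simpa using b.isPos_of_mem_support i.2
  mul_right_iff w i := by
    -- `s i` negates its own simple root, so `w * s i` sends that root to the negative of its image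
    -- under `w`.
    have h1 : P.weylGroupToPerm (w * simpleReflection b i) i =
        P.reflectionPerm (P.weylGroupToPerm w i) (P.weylGroupToPerm w i) := by
      apply P.root.injective
      rw [map_mul, Equiv.Perm.mul_apply, simpleReflection, weylGroupToPerm_ofIdx,
        ← weylGroup_apply_root, root_reflectionPerm, root_reflectionPerm, reflection_apply_self,
        reflection_apply_self, smul_neg, weylGroup_apply_root]
    have h2 := IsPos.neg_iff_not b (P.weylGroupToPerm w i)
    rw [h1]
    exact not_congr h2
  mul_left_iff w i j hw := by
    have h1 : P.weylGroupToPerm (simpleReflection b j * w) i =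
        P.reflectionPerm j (P.weylGroupToPerm w i) := by
      rw [map_mul, Equiv.Perm.mul_apply, simpleReflection, weylGroupToPerm_ofIdx]
    have h2 : ∀ k : ι, k = j → weylGroup.ofIdx P k = simpleReflection b j := by
      rintro k rfl; rfl
    -- If `w` sent the `i`-th simple root to plus (`h3`) or minus (`h4`) the `j`-th, conjugating `s
    -- i` by `w` would give `s j`, contrary to `hw`.
    have h3 : P.weylGroupToPerm w i ≠ j := by
      intro h3
      apply hw
      rw [← h2 _ h3, ← weylGroup_conj_ofIdx, inv_mul_cancel_right]
      rfl
    have h4 : P.reflectionPerm j (P.weylGroupToPerm w i) ≠ j := by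
      intro h4
      apply hw
      have h5 : weylGroup.ofIdx P (P.reflectionPerm j (P.weylGroupToPerm w i)) =
          weylGroup.ofIdx P (P.weylGroupToPerm (simpleReflection b j * w) i) := by rw [h1]
      rw [h2 _ h4, ← weylGroup_conj_ofIdx, eq_mul_inv_iff_mul_eq, mul_assoc] at h5
      exact mul_left_cancel h5
    rw [h1, not_iff_not]
    refine ⟨fun h5 ↦ ?_, fun h5 ↦ h5.reflectionPerm j.2 h3⟩
    simpa using h5.reflectionPerm j.2 h4

end Base
end RootPairing
end

theorem mainTheorem6 {ι V V' : Type*} [Finite ι] [AddCommGroup V] [Module ℝ V]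
    [AddCommGroup V'] [Module ℝ V'] (P : RootPairing ι ℝ V V') [P.IsRootSystem]
    [P.IsCrystallographic] [P.IsReduced] (b : P.Base) (q : ℝ) (hq : 1 < q) :
    ∃ H : Module.Basis P.weylGroup ℝ (HeckeAlgebra (simpleReflection b) q),
      IsStandardBasis (simpleReflection b) q H ∧
      (∀ x y z : P.weylGroup, 0 ≤ structureConstant H x y z) ∧
      IsMultigroup (basisOp H) 1 (fun w : P.weylGroup => w⁻¹) :=
  have h := b.isDescentRel_simpleReflection
  ⟨h.heckeBasis q, h.isStandardBasis_heckeBasis q, h.structureConstant_heckeBasis_nonneg q hq,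
    h.isMultigroup_heckeBasis hq⟩
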